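/- Let $\mathcal H$ be a real or complex Hilbert space, let $U_1,U_2$ be closed vector subspaces of $\mathcal H$ with orthogonal projectors $P_1,P_2$, and suppose that $U_1\cap U_2=\{0\}$. For $(u_1,u_2)\in U_1\times U_2$ set $S(u_1,u_2)=\{x\in\mathcal H : P_1x=u_1,\ P_2x=u_2\}$. Suppose that $(U_1,U_2)$ does not satisfy the inverse best approximation property, i.e., it is not true that $S(v_1,v_2)\neq\varnothing$ for every $(v_1,v_2)\in U_1\times U_2$. Let $(u_1,u_2)\in U_1\times U_2$ be such that $S(u_1,u_2)\neq\varnothing$ and, for $r\in\mathcal H$, let $B(r;u_1,u_2)$ be the best approximation to $r$ from $S(u_1,u_2)$. For $i\in\{1,2\}$, let $Q_i$ be the projector onto the closed affine subspace $u_i+U_i^\perp$. Then for every nonincreasing sequence $(\alpha_n)_{n\in\mathbb N}$ of real numbers with $\alpha_n\to 0$ there exists $r\in\mathcal H$ such that the sequence defined by $x_0=r$ and $x_{n+1}=Q_1Q_2x_n$ $(n\in\mathbb N)$ satisfies \[ \|x_n-B(r;u_1,u_2)\|\ge\alpha_n\qquad\text{for all } n\in\mathbb N . \] -/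

import Mathlib

open Filter Topology

namespace BestApprox

noncomputable section

/-- `p` is a best approximation to `x` from the set `C`. -/
def IsBestApprox {H : Type*} [NormedAddCommGroup H] (C : Set H) (x p : H) : Prop :=
  p ∈ C ∧ ∀ y ∈ C, ‖x - p‖ ≤ ‖x - y‖

open Classical in
/-- The metric projector `P_C`: it maps `x` to its best approximation from `C`. It is only used
for nonempty closed affine subspaces of a Hilbert space, for which the best approximation exists
and is unique (see the lemmas below). When there is no best
approximation the value is `x`, which plays no role. -/
def metricProj {H : Type*} [NormedAddCommGroup H] (C : Set H) (x : H) : H :=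
  if h : ∃ p, IsBestApprox C x p then h.choose else x

/-- The projector `P_i` onto the closed vector subspace `U_i` is Mathlib's orthogonal projection,
seen as an operator on `H`. -/
def proj {𝕜 H : Type*} [RCLike 𝕜] [NormedAddCommGroup H] [InnerProductSpace 𝕜 H] [CompleteSpace H]
    (U : ClosedSubmodule 𝕜 H) (x : H) : H :=
  U.toSubmodule.starProjection x

/-- The inverse best approximation property of `(U_1, …, U_m)`: any selection of points
`u_i ∈ U_i` is the family of the best approximations of one point. -/
def IBAP {𝕜 H : Type*} [RCLike 𝕜] [NormedAddCommGroup H] [InnerProductSpace 𝕜 H] [CompleteSpace H]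
    {m : ℕ} (U : Fin m → ClosedSubmodule 𝕜 H) : Prop :=
  ∀ u : ∀ i, U i, ∃ x : H, ∀ i, proj (U i) x = u i

/-- The set `S(u_1, …, u_m)` of the points `x` with `P_i x = u_i` for all `i`. -/
def solSet {𝕜 H : Type*} [RCLike 𝕜] [NormedAddCommGroup H] [InnerProductSpace 𝕜 H]
    [CompleteSpace H] {m : ℕ} (U : Fin m → ClosedSubmodule 𝕜 H) (u : ∀ i, U i) : Set H :=
  ⋂ i, {x : H | proj (U i) x = u i}

/-- `B(r; u_1, …, u_m)`, the best approximation to `r` from `S(u_1, …, u_m)`. -/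
def bestSol {𝕜 H : Type*} [RCLike 𝕜] [NormedAddCommGroup H] [InnerProductSpace 𝕜 H]
    [CompleteSpace H] {m : ℕ} (U : Fin m → ClosedSubmodule 𝕜 H) (u : ∀ i, U i) (r : H) : H :=
  metricProj (solSet U u) r

/-- `Q_i`, the projector onto the closed affine subspace `u_i + U_i^⊥`. -/
def affProj {𝕜 H : Type*} [RCLike 𝕜] [NormedAddCommGroup H] [InnerProductSpace 𝕜 H]
    [CompleteSpace H] {m : ℕ} (U : Fin m → ClosedSubmodule 𝕜 H) (u : ∀ i, U i) (i : Fin m)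
    (x : H) : H :=
  metricProj (AffineSubspace.mk' (u i : H) (U i).toSubmoduleᗮ : Set H) x

/-- One sweep `x ↦ Q_1 (Q_2 (⋯ (Q_m x)))` of the periodic projection algorithm. -/
def sweep {𝕜 H : Type*} [RCLike 𝕜] [NormedAddCommGroup H] [InnerProductSpace 𝕜 H]
    [CompleteSpace H] {m : ℕ} (U : Fin m → ClosedSubmodule 𝕜 H) (u : ∀ i, U i) (x : H) : H :=
  (List.finRange m).foldr (fun i y => affProj U u i y) x

/-- The periodic projection algorithm: `x_0 = r` and `x_{n+1} = Q_1 ⋯ Q_m x_n`. -/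
def iter {𝕜 H : Type*} [RCLike 𝕜] [NormedAddCommGroup H] [InnerProductSpace 𝕜 H]
    [CompleteSpace H] {m : ℕ} (U : Fin m → ClosedSubmodule 𝕜 H) (u : ∀ i, U i) (r : H) : ℕ → H
  | 0 => r
  | n + 1 => sweep U u (iter U u r n)

/-! Well-definedness of the projectors above. -/

/-- The best approximation from a closed affine subspace `a + K` is `a + P_K (x - a)`. -/
theorem isBestApprox_affine_iff {𝕜 H : Type*} [RCLike 𝕜] [NormedAddCommGroup H]
    [InnerProductSpace 𝕜 H] (K : Submodule 𝕜 H) [K.HasOrthogonalProjection] (a x p : H) :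
    IsBestApprox (AffineSubspace.mk' a K : Set H) x p ↔ p = a + K.starProjection (x - a) := by
  have pyth : ∀ y : H, y - a ∈ K → ‖x - y‖ * ‖x - y‖ =
      ‖x - (a + K.starProjection (x - a))‖ * ‖x - (a + K.starProjection (x - a))‖ +
      ‖(a + K.starProjection (x - a)) - y‖ * ‖(a + K.starProjection (x - a)) - y‖ := by
    intro y hy
    rw [← norm_add_sq_eq_norm_sq_add_norm_sq_of_inner_eq_zero (𝕜 := 𝕜)]
    · congr 2 <;> abel
    · have h1 : (a + K.starProjection (x - a)) - y ∈ K := by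
        have := K.sub_mem (K.starProjection_apply_mem (x - a)) hy
        convert this using 1; abel
      have h2 : x - (a + K.starProjection (x - a)) ∈ Kᗮ := by
        have := K.sub_starProjection_mem_orthogonal (x - a)
        convert this using 1; abel
      exact K.inner_left_of_mem_orthogonal h1 h2
  have hp : a + K.starProjection (x - a) ∈ AffineSubspace.mk' a K := by
    rw [AffineSubspace.mem_mk', vsub_eq_sub, add_sub_cancel_left]
    exact K.starProjection_apply_mem (x - a)
  constructor
  · rintro ⟨h1, h2⟩
    have h1' : p - a ∈ K := by simpa [AffineSubspace.mem_mk'] using h1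
    have h3 := h2 _ hp
    have h4 := pyth p h1'
    have h5 := mul_self_le_mul_self (norm_nonneg _) h3
    have h6 : ‖(a + K.starProjection (x - a)) - p‖ = 0 := by
      nlinarith [mul_self_nonneg ‖(a + K.starProjection (x - a)) - p‖]
    exact (sub_eq_zero.1 (norm_eq_zero.1 h6)).symm
  · rintro rfl
    refine ⟨hp, fun y hy => ?_⟩
    have hy' : y - a ∈ K := by simpa [AffineSubspace.mem_mk'] using hy
    have h4 := pyth y hy'
    refine le_of_not_gt fun hlt => ?_
    have h5 := mul_self_lt_mul_self (norm_nonneg _) hlt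
    have h6 := mul_self_nonneg (norm (a + K.starProjection (x - a) - y))
    linarith

theorem metricProj_affine {𝕜 H : Type*} [RCLike 𝕜] [NormedAddCommGroup H]
    [InnerProductSpace 𝕜 H] (K : Submodule 𝕜 H) [K.HasOrthogonalProjection] (a x : H) :
    metricProj (AffineSubspace.mk' a K : Set H) x = a + K.starProjection (x - a) := by
  have h : ∃ p, IsBestApprox (AffineSubspace.mk' a K : Set H) x p :=
    ⟨_, (isBestApprox_affine_iff K a x _).2 rfl⟩
  rw [metricProj, dif_pos h]
  exact (isBestApprox_affine_iff K a x _).1 h.choose_spec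

/-- `Q_i x = u_i + x - P_i x`. -/
theorem affProj_eq {𝕜 H : Type*} [RCLike 𝕜] [NormedAddCommGroup H] [InnerProductSpace 𝕜 H]
    [CompleteSpace H] {m : ℕ} (U : Fin m → ClosedSubmodule 𝕜 H) (u : ∀ i, U i) (i : Fin m)
    (x : H) : affProj U u i x = u i + x - proj (U i) x := by
  have h : (U i).toSubmodule.starProjection (u i : H) = u i :=
    Submodule.starProjection_eq_self_iff.2 (u i).2
  rw [affProj, metricProj_affine, Submodule.starProjection_orthogonal_val, map_sub, h, proj]
  abel

/-- If `S(u_1, …, u_m)` is nonempty, then it is `y + ⋂ U_i^⊥` for each of its points `y`. -/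
theorem solSet_eq {𝕜 H : Type*} [RCLike 𝕜] [NormedAddCommGroup H] [InnerProductSpace 𝕜 H]
    [CompleteSpace H] {m : ℕ} (U : Fin m → ClosedSubmodule 𝕜 H) (u : ∀ i, U i) {y : H}
    (hy : y ∈ solSet U u) :
    solSet U u =
      (AffineSubspace.mk' y (⨅ i, (U i)ᗮ : ClosedSubmodule 𝕜 H).toSubmodule : Set H) := by
  have hy' : ∀ i, (U i).toSubmodule.starProjection y = u i := by
    simpa [solSet, proj] using hy
  ext x
  have key : ∀ i, proj (U i) x = u i ↔ x - y ∈ (U i).toSubmoduleᗮ := fun i => by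
    rw [← Submodule.starProjection_apply_eq_zero_iff, map_sub, hy', sub_eq_zero, proj]
  simp only [solSet, Set.mem_iInter, Set.mem_ofPred_eq, key, SetLike.mem_coe,
    AffineSubspace.mem_mk', vsub_eq_sub, ClosedSubmodule.toSubmodule_iInf, Submodule.mem_iInf]
  rfl

/-- `B(r; u_1, …, u_m)` is the unique best approximation to `r` from `S(u_1, …, u_m)` if this set
is nonempty. -/
theorem isBestApprox_solSet_iff {𝕜 H : Type*} [RCLike 𝕜] [NormedAddCommGroup H]
    [InnerProductSpace 𝕜 H] [CompleteSpace H] {m : ℕ} (U : Fin m → ClosedSubmodule 𝕜 H)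
    (u : ∀ i, U i) (hS : (solSet U u).Nonempty) (r p : H) :
    IsBestApprox (solSet U u) r p ↔ p = bestSol U u r := by
  obtain ⟨y, hy⟩ := hS
  rw [bestSol, solSet_eq U u hy, metricProj_affine, isBestApprox_affine_iff]

end

end BestApprox

/-! Let `V` be the intersection of the `(U i)ᗮ` and `T` the product of the projectors onto `(U 0)ᗮ`
and `(U 1)ᗮ`. For `y` in the solution set, the error after `n` sweeps is `T ^ n` applied to the
`Vᗮ`-component of `r - y` (`iter_sub_bestSol`), so a slow orbit of `T` on `Vᗮ` is needed. Were the
projections bounded below on `Vᗮ`, the map `x ↦ (P_i x)` would have closed range, dense by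
independence, and the property would hold. So there are unit vectors `w m` in `Vᗮ` whose projections
tend to `0` (`exists_unit_seq_tendsto_proj`). They are weakly null, and each fixed `T ^ n` almost
fixes them. A gliding hump (`exists_forall_le_norm_apply`) sums geometrically decreasing multiples
of some `w m`, each hump keeping the error large up to a prescribed time. -/

namespace BestApprox

/-! ### Gliding hump: orbits that decay slowly. -/

section SlowDecay

variable {𝕜 H : Type*} [RCLike 𝕜] [NormedAddCommGroup H] [InnerProductSpace 𝕜 H] [CompleteSpace H]

/-- Adding a multiple of a weakly null sequence increases squared norms asymptotically. -/
theorem tendsto_norm_sq_map_add_smul (R : H →L[𝕜] H) {w : ℕ → H}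
    (hweak : ∀ v, Tendsto (fun m => inner 𝕜 v (w m)) atTop (𝓝 0))
    (hRw : Tendsto (fun m => ‖R (w m)‖) atTop (𝓝 1)) (z : H) (c : ℝ) :
    Tendsto (fun m => ‖R (z + (c : 𝕜) • w m)‖ ^ 2) atTop (𝓝 (‖R z‖ ^ 2 + c ^ 2)) := by
  have h1 : ∀ m, ‖R (z + (c : 𝕜) • w m)‖ ^ 2 = ‖R z‖ ^ 2 +
      2 * (c * RCLike.re (inner 𝕜 (ContinuousLinearMap.adjoint R (R z)) (w m))) +
      c ^ 2 * ‖R (w m)‖ ^ 2 := by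
    intro m
    rw [map_add, map_smul, norm_add_sq (𝕜 := 𝕜), inner_smul_right, norm_smul,
      ContinuousLinearMap.adjoint_inner_left, RCLike.re_ofReal_mul, mul_pow, RCLike.norm_ofReal,
      sq_abs]
  simp only [h1]
  have h2 : Tendsto (fun m => RCLike.re (inner 𝕜 (ContinuousLinearMap.adjoint R (R z)) (w m)))
      atTop (𝓝 0) := by
    simpa [Function.comp_def] using (RCLike.continuous_re.tendsto (0 : 𝕜)).comp
      (hweak (ContinuousLinearMap.adjoint R (R z)))
  simpa using ((h2.const_mul c).const_mul 2).const_add (‖R z‖ ^ 2) |>.add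
    ((hRw.pow 2).const_mul (c ^ 2))

/-- If bounded operators `R n` with pointwise nonincreasing norms almost preserve the norms of a
weakly null sequence of unit vectors, then some orbit `R n z` decays more slowly than a prescribed
null sequence. -/
theorem exists_forall_le_norm_apply (R : ℕ → H →L[𝕜] H)
    (hR : ∀ x, Antitone fun n => ‖R n x‖) {w : ℕ → H} (hw : ∀ m, ‖w m‖ = 1)
    (hweak : ∀ v, Tendsto (fun m => inner 𝕜 v (w m)) atTop (𝓝 0))
    (hRw : ∀ n, Tendsto (fun m => ‖R n (w m)‖) atTop (𝓝 1))
    {α : ℕ → ℝ} (hα : Antitone α) (hα0 : Tendsto α atTop (𝓝 0)) :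
    ∃ z : H, ∀ n, α n ≤ ‖R n z‖ := by
  have hα_nonneg : 0 ≤ α 0 := hα.le_of_tendsto hα0 0
  set a : ℕ → ℝ := fun k => (α 0 + 1) * (1 / 2) ^ k with ha
  have ha_pos : ∀ k, 0 < a k := fun k => by positivity
  -- The level `a j` has to be held until time `M (j + 1)`, when `α` has dropped to `a (j + 1)`.
  have hM : ∀ k, ∃ M, k ≤ M ∧ α M ≤ a k := fun k =>
    ((eventually_ge_atTop k).and (hα0.eventually_le_const (ha_pos k))).exists
  choose M hkM hMa using hM
  have step : ∀ k z, ∃ z', dist z z' ≤ 2 * (α 0 + 1) * (1 / 2) ^ k ∧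
      ((∀ j < k, a j < ‖R (M (j + 1)) z‖) → ∀ j < k + 1, a j < ‖R (M (j + 1)) z'‖) := by
    intro k z
    by_cases hz : ∀ j < k, a j < ‖R (M (j + 1)) z‖
    · have hev : ∀ j ∈ Finset.range (k + 1), ∀ᶠ m in atTop,
          a j ^ 2 < ‖R (M (j + 1)) (z + ((2 * a k : ℝ) : 𝕜) • w m)‖ ^ 2 := by
        intro j hj
        -- The hump adds `(2 * a k) ^ 2` to every limit: old strict bounds survive, and the new one
        -- holds since `2 * a k > a k`.
        refine (tendsto_norm_sq_map_add_smul (R (M (j + 1))) hweak (hRw _) z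
          (2 * a k)).eventually_const_lt ?_
        rcases (Nat.lt_succ_iff.1 (Finset.mem_range.1 hj)).lt_or_eq with h | rfl
        · nlinarith [hz j h, ha_pos j, sq_nonneg (2 * a k)]
        · nlinarith [ha_pos j, sq_nonneg ‖R (M (j + 1)) z‖]
      obtain ⟨m, hm⟩ := ((Finset.eventually_all _).2 hev).exists
      refine ⟨z + ((2 * a k : ℝ) : 𝕜) • w m, ?_, fun _ j hj => ?_⟩
      · rw [dist_self_add_right, norm_smul, hw, RCLike.norm_ofReal, abs_of_pos (by positivity), ha]
        exact le_of_eq (by ring)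
      · exact lt_of_pow_lt_pow_left₀ 2 (norm_nonneg _) (hm j (Finset.mem_range.2 hj))
    · exact ⟨z, by rw [dist_self]; positivity, fun h => absurd h hz⟩
  choose f hf_dist hf using step
  let z : ℕ → H := fun k => Nat.rec 0 f k
  have hz : ∀ k, ∀ j < k, a j < ‖R (M (j + 1)) (z k)‖ := by
    intro k
    induction k with
    | zero => intro j hj; omega
    | succ k ih => exact hf k (z k) ih
  obtain ⟨y, hy⟩ := cauchySeq_tendsto_of_complete
    (cauchySeq_of_le_geometric (1 / 2) (2 * (α 0 + 1)) (by norm_num)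
      (fun k => hf_dist k (z k) : ∀ k, dist (z k) (z (k + 1)) ≤ _))
  have hya : ∀ j, a j ≤ ‖R (M (j + 1)) y‖ := fun j =>
    ge_of_tendsto (((R (M (j + 1))).continuous.tendsto y).comp hy).norm
      ((eventually_gt_atTop j).mono fun k hk => (hz k j hk).le)
  refine ⟨y, fun n => ?_⟩
  have hex : ∃ k, n < M (k + 1) := ⟨n, hkM (n + 1)⟩
  classical
  -- Index `0` is covered by `a 0 = α 0 + 1`; at index `k + 1`, minimality gives `M (k + 1) ≤ n`.
  have hαa : α n ≤ a (Nat.find hex) := by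
    rcases h : Nat.find hex with _ | k
    · exact (hα n.zero_le).trans (by simp [ha])
    · have := Nat.find_min hex (m := k) (by omega)
      exact (hα (not_lt.1 this)).trans (hMa _)
  exact hαa.trans ((hya _).trans (hR y (Nat.find_spec hex).le))

end SlowDecay

/-! ### Closed range, weakly null sequences and the linearized sweep. -/

section TwoSubspaces

variable {𝕜 H : Type*} [RCLike 𝕜] [NormedAddCommGroup H] [InnerProductSpace 𝕜 H]

theorem mem_iInf_orthogonal {m : ℕ} {U : Fin m → ClosedSubmodule 𝕜 H} {x : H} :
    x ∈ (⨅ i, (U i)ᗮ : ClosedSubmodule 𝕜 H).toSubmodule ↔ ∀ i, x ∈ (U i).toSubmoduleᗮ := by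
  simp only [ClosedSubmodule.toSubmodule_iInf, Submodule.mem_iInf]
  rfl

theorem eq_zero_of_sum_eq_zero {U : Fin 2 → ClosedSubmodule 𝕜 H}
    (hU : (U 0 : Set H) ∩ (U 1 : Set H) = {0}) (g : ∀ i, U i) (hg : ∑ i, (g i : H) = 0) :
    g = 0 := by
  rw [Fin.sum_univ_two] at hg
  have h0 : (g 0 : H) = 0 := by
    have hmem : (g 0 : H) ∈ (U 0 : Set H) ∩ (U 1 : Set H) :=
      ⟨(g 0).2, by
        rw [eq_neg_of_add_eq_zero_left hg]; exact (U 1).toSubmodule.neg_mem (g 1).2⟩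
    rwa [hU] at hmem
  have h1 : (g 1 : H) = 0 := by rwa [h0, zero_add] at hg
  funext i
  fin_cases i
  · exact Subtype.ext h0
  · exact Subtype.ext h1

variable [CompleteSpace H]

/-- If the projections are jointly bounded below on the orthogonal complement of `⋂ U_i^⊥`, then
independent subspaces have the inverse best approximation property. -/
theorem IBAP.of_bounded_below {m : ℕ} {U : Fin m → ClosedSubmodule 𝕜 H}
    (hU : ∀ g : ∀ i, U i, ∑ i, (g i : H) = 0 → g = 0) {c : ℝ} (hc : 0 < c)
    (hbdd : ∀ x ∈ (⨅ i, (U i)ᗮ : ClosedSubmodule 𝕜 H).toSubmoduleᗮ,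
      c * ‖x‖ ≤ ∑ i, ‖proj (U i) x‖) : IBAP U := by
  set V := (⨅ i, (U i)ᗮ : ClosedSubmodule 𝕜 H).toSubmodule with hV
  let L : Vᗮ →L[𝕜] PiLp 2 (fun i => (U i).toSubmodule) :=
    (PiLp.continuousLinearEquiv 2 𝕜 (fun i => (U i).toSubmodule)).symm.toContinuousLinearMap ∘L
      (ContinuousLinearMap.pi fun i => (U i).toSubmodule.orthogonalProjectionOnto) ∘L Vᗮ.subtypeL
  have hL : ∀ x i, ((L x i : (U i).toSubmodule) : H) = proj (U i) x := fun x i => rfl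
  have hanti : ∃ K, AntilipschitzWith K L := by
    refine ⟨_, L.antilipschitz_of_bound (K := Real.toNNReal (m / c)) fun x => ?_⟩
    have h1 : ∑ i, ‖proj (U i) (x : H)‖ ≤ m * ‖L x‖ := by
      have : ∀ i ∈ Finset.univ, ‖proj (U i) (x : H)‖ ≤ ‖L x‖ := fun i _ => by
        rw [← hL]
        exact PiLp.norm_apply_le (L x) i
      simpa using Finset.sum_le_sum this
    rw [Real.coe_toNNReal _ (by positivity), div_mul_eq_mul_div, le_div_iff₀ hc]
    have h2 := hbdd x x.2
    rw [Submodule.coe_norm]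
    linarith
  obtain ⟨K, hK⟩ := hanti
  have hclosed : IsClosed (L.range : Set (PiLp 2 (fun i => (U i).toSubmodule))) := by
    have := hK.isClosed_range L.uniformContinuous
    exact this
  -- If `g` is orthogonal to the range, `∑ i, g i` is orthogonal to `Vᗮ` but also lies in it, hence
  -- vanishes.
  have horth : L.rangeᗮ = ⊥ := by
    rw [Submodule.eq_bot_iff]
    intro g hg
    have h1 : ∀ x : Vᗮ, inner 𝕜 (x : H) (∑ i, (g i : H)) = 0 := by
      intro x
      have := (Submodule.mem_orthogonal _ _).1 hg (L x) ⟨x, rfl⟩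
      rw [PiLp.inner_apply] at this
      rw [inner_sum, ← this]
      refine Finset.sum_congr rfl fun i _ => ?_
      rw [Submodule.coe_inner, hL, proj, Submodule.inner_starProjection_left_eq_right,
        Submodule.starProjection_eq_self_iff.2 (g i).2]
    have h2 : ∑ i, (g i : H) ∈ Vᗮ := Submodule.sum_mem _ fun i _ =>
      (Submodule.mem_orthogonal' _ _).2 fun v hv =>
        (Submodule.mem_orthogonal _ _).1 (mem_iInf_orthogonal.1 hv i) _ (g i).2
    have h3 := hU (fun i => g i) (inner_self_eq_zero.1 (h1 ⟨_, h2⟩))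
    ext i
    simpa using congrArg (fun v : H => v) (congrArg Subtype.val (congrFun h3 i))
  have htop : L.range = ⊤ := by
    have : ∀ i, CompleteSpace (U i).toSubmodule := fun i => (U i).isClosed.completeSpace_coe
    have : CompleteSpace L.range := hclosed.completeSpace_coe
    exact Submodule.orthogonal_eq_bot_iff.1 horth
  intro u
  let u' : PiLp 2 (fun i => (U i).toSubmodule) := WithLp.toLp 2 u
  obtain ⟨x, hx⟩ : u' ∈ L.range := htop ▸ Submodule.mem_top
  exact ⟨x, fun i => by rw [← hL]; exact congrArg (fun g => ((g i : (U i).toSubmodule) : H)) hx⟩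

/-- A bounded sequence in the orthogonal complement of `⋂ U_i^⊥` whose projections tend to `0`
tends weakly to `0`. -/
theorem tendsto_inner_zero_of_tendsto_proj {m : ℕ} {U : Fin m → ClosedSubmodule 𝕜 H} {w : ℕ → H}
    (hw : ∀ n, ‖w n‖ = 1) (hwV : ∀ n, w n ∈ (⨅ i, (U i)ᗮ : ClosedSubmodule 𝕜 H).toSubmoduleᗮ)
    (hproj : ∀ i, Tendsto (fun n => proj (U i) (w n)) atTop (𝓝 0)) (v : H) :
    Tendsto (fun n => inner 𝕜 v (w n)) atTop (𝓝 0) := by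
  set V := (⨅ i, (U i)ᗮ : ClosedSubmodule 𝕜 H).toSubmodule with hV
  let W : Submodule 𝕜 H :=
    { carrier := {v | Tendsto (fun n => inner 𝕜 v (w n)) atTop (𝓝 0)}
      add_mem' := fun {a b} ha hb => by
        have : Tendsto _ _ _ := Tendsto.add ha hb
        simpa [inner_add_left] using this
      zero_mem' := by simp
      smul_mem' := fun c a ha => by
        have : Tendsto _ _ _ := Tendsto.const_mul (starRingEnd 𝕜 c) ha
        simpa [inner_smul_left] using this }
  have hUW : ∀ i, (U i).toSubmodule ≤ W := by
    intro i v hv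
    have h : Tendsto (fun n => inner 𝕜 v (proj (U i) (w n))) atTop (𝓝 (inner 𝕜 v 0)) :=
      tendsto_const_nhds.inner (hproj i)
    refine Tendsto.congr (fun n => ?_) (inner_zero_right (𝕜 := 𝕜) v ▸ h)
    rw [proj, ← Submodule.inner_starProjection_left_eq_right,
      Submodule.starProjection_eq_self_iff.2 hv]
  have hVW : V ≤ W := fun v hv => by
    have : ∀ n, inner 𝕜 v (w n) = 0 := fun n => (Submodule.mem_orthogonal _ _).1 (hwV n) v hv
    change Tendsto _ _ _
    simp [this]
  -- A vector orthogonal to `W` is orthogonal to every `U i`, so it lies in `V ≤ W` and is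
  -- orthogonal to itself.
  have hdense : W.topologicalClosure = ⊤ := by
    rw [Submodule.topologicalClosure_eq_top_iff, Submodule.eq_bot_iff]
    intro x hx
    have hxV : x ∈ V := mem_iInf_orthogonal.2 fun i => Submodule.orthogonal_le (hUW i) hx
    exact inner_self_eq_zero.1 ((Submodule.mem_orthogonal _ _).1 hx x (hVW hxV))
  rw [Metric.tendsto_atTop]
  intro ε hε
  have hv : v ∈ closure (W : Set H) := by
    rw [← Submodule.topologicalClosure_coe, hdense]; trivial
  obtain ⟨v', hv', hd⟩ := Metric.mem_closure_iff.1 hv (ε / 2) (half_pos hε)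
  obtain ⟨n₀, hn₀⟩ := Metric.tendsto_atTop.1 (show Tendsto _ _ _ from hv') (ε / 2) (half_pos hε)
  refine ⟨n₀, fun n hn => ?_⟩
  have h1 := hn₀ n hn
  rw [dist_zero_right] at h1 ⊢
  have h2 : inner 𝕜 v (w n) = inner 𝕜 (v - v') (w n) + inner 𝕜 v' (w n) := by
    rw [inner_sub_left]; ring
  have h3 : ‖inner 𝕜 (v - v') (w n)‖ ≤ ‖v - v'‖ * ‖w n‖ := norm_inner_le_norm _ _
  rw [hw, mul_one, ← dist_eq_norm] at h3
  rw [h2]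
  linarith [norm_add_le (inner 𝕜 (v - v') (w n)) (inner 𝕜 v' (w n))]

/-- Without the inverse best approximation property, independent subspaces admit unit vectors in
the orthogonal complement of `⋂ U_i^⊥` whose projections all tend to `0`. -/
theorem exists_unit_seq_tendsto_proj {m : ℕ} {U : Fin m → ClosedSubmodule 𝕜 H}
    (hU : ∀ g : ∀ i, U i, ∑ i, (g i : H) = 0 → g = 0) (hIBAP : ¬ IBAP U) :
    ∃ w : ℕ → H, (∀ n, ‖w n‖ = 1) ∧
      (∀ n, w n ∈ (⨅ i, (U i)ᗮ : ClosedSubmodule 𝕜 H).toSubmoduleᗮ) ∧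
      ∀ i, Tendsto (fun n => proj (U i) (w n)) atTop (𝓝 0) := by
  have h : ∀ n : ℕ, ∃ w : H, ‖w‖ = 1 ∧
      w ∈ (⨅ i, (U i)ᗮ : ClosedSubmodule 𝕜 H).toSubmoduleᗮ ∧
      ∀ i, ‖proj (U i) w‖ ≤ 1 / ((n : ℝ) + 1) := by
    intro n
    by_contra! hcon
    refine hIBAP (IBAP.of_bounded_below hU (c := 1 / ((n : ℝ) + 1)) (by positivity) fun x hx => ?_)
    rcases eq_or_ne x 0 with rfl | hx0
    · simp [proj]
    have hx1 : ((‖x‖⁻¹ : ℝ) : 𝕜) • x ∈ (⨅ i, (U i)ᗮ : ClosedSubmodule 𝕜 H).toSubmoduleᗮ :=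
      Submodule.smul_mem _ _ hx
    have hpos : 0 < ‖x‖ := norm_pos_iff.2 hx0
    obtain ⟨i, hi⟩ := hcon _ (by
      rw [norm_smul, RCLike.norm_ofReal, abs_of_pos (inv_pos.2 hpos),
        inv_mul_cancel₀ hpos.ne']) hx1
    rw [proj, map_smul, norm_smul, RCLike.norm_ofReal, abs_of_pos (inv_pos.2 hpos),
      inv_mul_eq_div, lt_div_iff₀ hpos] at hi
    exact hi.le.trans (Finset.single_le_sum (f := fun i => ‖proj (U i) x‖)
      (fun i _ => norm_nonneg _) (Finset.mem_univ i))
  choose w hw hwV hproj using h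
  exact ⟨w, hw, hwV, fun i => squeeze_zero_norm (fun n => hproj n i)
    tendsto_one_div_add_atTop_nhds_zero_nat⟩

/-- The linear part of a sweep for two subspaces. -/
noncomputable def sweepLinear (U : Fin 2 → ClosedSubmodule 𝕜 H) : H →L[𝕜] H :=
  (U 0).toSubmoduleᗮ.starProjection * (U 1).toSubmoduleᗮ.starProjection

theorem sweepLinear_apply (U : Fin 2 → ClosedSubmodule 𝕜 H) (x : H) :
    sweepLinear U x = x - proj (U 1) x - proj (U 0) (x - proj (U 1) x) := by
  simp only [sweepLinear, mul_apply_eq_comp, Submodule.starProjection_orthogonal_val,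
    proj]

theorem norm_sweepLinear_apply_le (U : Fin 2 → ClosedSubmodule 𝕜 H) (x : H) :
    ‖sweepLinear U x‖ ≤ ‖x‖ :=
  (Submodule.norm_starProjection_apply_le _ _).trans (Submodule.norm_starProjection_apply_le _ _)

theorem sweepLinear_pow_apply_of_mem {U : Fin 2 → ClosedSubmodule 𝕜 H} {x : H}
    (hx : x ∈ (⨅ i, (U i)ᗮ : ClosedSubmodule 𝕜 H).toSubmodule) (n : ℕ) :
    (sweepLinear U ^ n) x = x := by
  induction n with
  | zero => simp
  | succ n ih =>
    have h := mem_iInf_orthogonal.1 hx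
    rw [pow_succ, mul_apply_eq_comp, sweepLinear, mul_apply_eq_comp,
      Submodule.starProjection_eq_self_iff.2 (h 1), Submodule.starProjection_eq_self_iff.2 (h 0),
      ← sweepLinear, ih]

theorem sweep_sub {U : Fin 2 → ClosedSubmodule 𝕜 H} {u : ∀ i, U i} {y : H}
    (hy : y ∈ solSet U u) (x : H) : sweep U u x - y = sweepLinear U (x - y) := by
  have hy' : ∀ i, proj (U i) y = u i := by simpa [solSet] using hy
  have h : ∀ i x, affProj U u i x - y = (x - y) - proj (U i) (x - y) := fun i x => by
    rw [affProj_eq, ← hy' i]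
    simp only [proj, map_sub]
    abel
  have hs : sweep U u x = affProj U u 0 (affProj U u 1 x) := by
    simp [sweep, List.finRange_succ]
  rw [hs, h, h, sweepLinear_apply]

/-- The best approximation is `y` plus the `V`-component of `r - y`, which every power of
`sweepLinear U` fixes. -/
theorem iter_sub_bestSol {U : Fin 2 → ClosedSubmodule 𝕜 H} {u : ∀ i, U i} {y : H}
    (hy : y ∈ solSet U u) (r : H) (n : ℕ) :
    iter U u r n - bestSol U u r = (sweepLinear U ^ n)
      ((⨅ i, (U i)ᗮ : ClosedSubmodule 𝕜 H).toSubmoduleᗮ.starProjection (r - y)) := by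
  have hit : iter U u r n - y = (sweepLinear U ^ n) (r - y) := by
    induction n with
    | zero => simp [iter]
    | succ n ih => rw [iter, sweep_sub hy, ih, pow_succ', mul_apply_eq_comp]
  rw [bestSol, solSet_eq U u hy, metricProj_affine, Submodule.starProjection_orthogonal_val,
    map_sub (sweepLinear U ^ n), sweepLinear_pow_apply_of_mem (Submodule.starProjection_apply_mem _ _), ← hit]
  abel

/-- With `T = sweepLinear U`, `T w - w = P_0 P_1 w - P_1 w - P_0 w`; powers follow by telescoping
and continuity. -/
theorem tendsto_sweepLinear_pow_sub {U : Fin 2 → ClosedSubmodule 𝕜 H} {w : ℕ → H}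
    (hproj : ∀ i, Tendsto (fun m => proj (U i) (w m)) atTop (𝓝 0)) (n : ℕ) :
    Tendsto (fun m => (sweepLinear U ^ n) (w m) - w m) atTop (𝓝 0) := by
  induction n with
  | zero => simp
  | succ n ih =>
    have h0 : Tendsto (fun m => proj (U 0) (proj (U 1) (w m))) atTop (𝓝 0) := by
      have := ((U 0).toSubmodule.starProjection.continuous.tendsto 0).comp (hproj 1)
      simpa [proj, Function.comp_def] using this
    have h1 : Tendsto (fun m => sweepLinear U (w m) - w m) atTop (𝓝 0) := by
      have := (h0.sub (hproj 1)).sub (hproj 0)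
      rw [sub_zero, sub_zero] at this
      refine this.congr fun m => ?_
      rw [sweepLinear_apply]
      simp only [proj, map_sub]
      abel
    have h2 := (((sweepLinear U ^ n).continuous.tendsto 0).comp h1).add ih
    rw [map_zero, add_zero] at h2
    refine h2.congr fun m => ?_
    rw [Function.comp_apply, map_sub, pow_succ, mul_apply_eq_comp]
    abel

end TwoSubspaces

end BestApprox

theorem proposition3p3 {𝕜 H : Type*} [RCLike 𝕜] [NormedAddCommGroup H] [InnerProductSpace 𝕜 H]
    [CompleteSpace H] (U : Fin 2 → ClosedSubmodule 𝕜 H)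
    (hU : (U 0 : Set H) ∩ (U 1 : Set H) = {0})
    (hIBAP : ¬ BestApprox.IBAP U)
    (u : ∀ i, U i) (hS : (BestApprox.solSet U u).Nonempty)
    (α : ℕ → ℝ) (hα : Antitone α) (hα0 : Tendsto α atTop (𝓝 0)) :
    ∃ r : H, ∀ n : ℕ, α n ≤ ‖BestApprox.iter U u r n - BestApprox.bestSol U u r‖ := by
  obtain ⟨y, hy⟩ := hS
  obtain ⟨w, hw, hwV, hproj⟩ :=
    BestApprox.exists_unit_seq_tendsto_proj (BestApprox.eq_zero_of_sum_eq_zero hU) hIBAP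
  obtain ⟨z, hz⟩ := BestApprox.exists_forall_le_norm_apply
    -- Including the projector onto `Vᗮ` makes these operators give the exact error from `y + z`,
    -- whether or not `z` lies in `Vᗮ`.
    (fun n => BestApprox.sweepLinear U ^ n *
      (⨅ i, (U i)ᗮ : ClosedSubmodule 𝕜 H).toSubmoduleᗮ.starProjection)
    (fun x => antitone_nat_of_succ_le fun n => by
      simp only [mul_apply_eq_comp, pow_succ' (BestApprox.sweepLinear U) n]
      exact BestApprox.norm_sweepLinear_apply_le U _) hw
    (BestApprox.tendsto_inner_zero_of_tendsto_proj hw hwV hproj)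
    (fun n => by
      have h : Tendsto (fun m => ‖(BestApprox.sweepLinear U ^ n) (w m)‖ - ‖w m‖) atTop (𝓝 0) :=
        squeeze_zero_norm (fun m => abs_norm_sub_norm_le _ _)
          (tendsto_zero_iff_norm_tendsto_zero.1
            (BestApprox.tendsto_sweepLinear_pow_sub hproj n))
      have h' := h.add_const 1
      rw [zero_add] at h'
      refine h'.congr fun m => ?_
      rw [mul_apply_eq_comp, Submodule.starProjection_eq_self_iff.2 (hwV m), hw]
      ring) hα hα0
  refine ⟨y + z, fun n => ?_⟩
  rw [BestApprox.iter_sub_bestSol hy, add_sub_cancel_left]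
  exact hz n
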